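/- Let $M$ be a connected complex manifold of dimension $2$, with holomorphic tangent bundle $T'M$, and let $(M,F)$ be a complex Finsler space: $F:T'M\to\mathbb R$ is continuous, $F\ge 0$ with $F(z,\eta)=0$ iff $\eta=0$, $F(z,\lambda\eta)=|\lambda|F(z,\eta)$ for all $\lambda\in\mathbb C$, $L:=F^2$ is ($C^\infty$-)smooth on $T'M\setminus\{0\}$, and in local coordinates $(z^k,\eta^k)$ the Hermitian matrix $g_{i\bar j}:=\partial^2L/\partial\eta^i\partial\bar\eta^j$ is positive definite there. Let $(g^{\bar m k})$ be the inverse matrix ($g_{l\bar m}g^{\bar mk}=\delta_l^k$) and let $$N^k_j=g^{\bar mk}\frac{\partial g_{l\bar m}}{\partial z^j}\eta^l,\quad \delta_k=\frac{\partial}{\partial z^k}-N_k^j\frac{\partial}{\partial\eta^j},\quad L^i_{jk}=g^{\bar li}\delta_kg_{j\bar l},\quad C^i_{jk}=g^{\bar li}\frac{\partial g_{j\bar l}}{\partial\eta^k},\quad T^i_{jk}=L^i_{jk}-L^i_{kj}$$ be the data of the Chern-Finsler connection, and $$R_{\bar rj\bar hk}=g_{i\bar r}R^i_{j\bar hk},\qquad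 R^i_{j\bar hk}=-\delta_{\bar h}L^i_{jk}-\delta_{\bar h}(N^l_k)\,C^i_{jl}$$ its horizontal curvature ($\delta_{\bar h}=\overline{\delta_h}$); an index $0$ (resp. $\bar 0$) denotes contraction with $\eta$ (resp. $\bar\eta$). Put $l^i=\eta^i/F$, $l_i=g_{i\bar j}\bar\eta^j/F$, $(m^1,m^2)=\big(\det(g_{i\bar j})\big)^{-1/2}(-l_2,l_1)$ and $$A=m^jm^kl_hC^h_{kj},\qquad J=l^jl^kl_iL^i_{jk},\qquad \mathbf K=-\frac1F\,\bar\eta^h\delta_{\bar h}J .$$ The functions $|A|$ and $\mathbf K$ on $T'M\setminus\{0\}$ do not depend on the local coordinates. **Theorem 4.9.** Suppose that the weak symmetry condition $R_{\bar 0k\bar 00}=R_{\bar 00\bar 0k}$ holds for all $k$ everywhere on $T'M\setminus\{0\}$, that $|A|\neq0$ (that is, $A$ does not vanish identically, so that $F$ is not purely Hermitian), and that $\mathbf K$ is a nonzero constant. Then $(M,F)$ is weakly Kähler: $g_{i\bar l}T^i_{jk}\eta^j\bar\eta^l=0$ for all $k$ everywhere on $T'M\setminus\{0\}$. -/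

import Mathlib

open scoped Manifold ContDiff ComplexConjugate ComplexOrder

noncomputable section

namespace CFinsler

/-! ## Wirtinger derivatives in the coordinates `(z, η)` of the holomorphic tangent bundle -/

/-- Coordinate space of the holomorphic tangent bundle: pairs `(z, η)`. -/
abbrev TCoord (n : ℕ) : Type := (Fin n → ℂ) × (Fin n → ℂ)

/-- `∂f/∂z^k = (1/2) (∂f/∂x^k - i ∂f/∂y^k)`, where `z^k = x^k + i y^k`. -/
def dz {n : ℕ} (k : Fin n) (f : TCoord n → ℂ) (p : TCoord n) : ℂ :=
  (1 / 2) * (fderiv ℝ f p (Pi.single k 1, 0) - Complex.I * fderiv ℝ f p (Pi.single k Complex.I, 0))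

/-- `∂f/∂z̄^k`. -/
def dzBar {n : ℕ} (k : Fin n) (f : TCoord n → ℂ) (p : TCoord n) : ℂ :=
  (1 / 2) * (fderiv ℝ f p (Pi.single k 1, 0) + Complex.I * fderiv ℝ f p (Pi.single k Complex.I, 0))

/-- `∂f/∂η^k`. -/
def deta {n : ℕ} (k : Fin n) (f : TCoord n → ℂ) (p : TCoord n) : ℂ :=
  (1 / 2) * (fderiv ℝ f p (0, Pi.single k 1) - Complex.I * fderiv ℝ f p (0, Pi.single k Complex.I))

/-- `∂f/∂η̄^k`. -/
def detaBar {n : ℕ} (k : Fin n) (f : TCoord n → ℂ) (p : TCoord n) : ℂ :=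
  (1 / 2) * (fderiv ℝ f p (0, Pi.single k 1) + Complex.I * fderiv ℝ f p (0, Pi.single k Complex.I))

/-! ## The Chern-Finsler connection and its curvature in local coordinates

Throughout, `Φ : TCoord n → ℝ` is the local expression of the metric function `F`. -/

/-- `L = F²`, as a complex-valued function. -/
def Lfun {n : ℕ} (Φ : TCoord n → ℝ) (p : TCoord n) : ℂ := ((Φ p ^ 2 : ℝ) : ℂ)

/-- The fundamental metric tensor `g_{i j̄} = ∂²L / ∂η^i ∂η̄^j`. -/
def g {n : ℕ} (Φ : TCoord n → ℝ) (i j : Fin n) : TCoord n → ℂ :=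
  deta i (detaBar j (Lfun Φ))

/-- The matrix `(g_{i j̄})`, with row index `i` and column index `j`. -/
def gMat {n : ℕ} (Φ : TCoord n → ℝ) (p : TCoord n) : Matrix (Fin n) (Fin n) ℂ :=
  Matrix.of fun i j => g Φ i j p

/-- The inverse metric `g^{m̄ k}`, determined by `∑ₘ g_{l m̄} g^{m̄ k} = δ_l^k`. -/
def gInv {n : ℕ} (Φ : TCoord n → ℝ) (m k : Fin n) (p : TCoord n) : ℂ :=
  (gMat Φ p)⁻¹ m k

/-- The Chern-Finsler nonlinear connection, `N Φ k j` being
`N^k_j = g^{m̄ k} (∂g_{l m̄}/∂z^j) η^l`. -/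
def N {n : ℕ} (Φ : TCoord n → ℝ) (k j : Fin n) (p : TCoord n) : ℂ :=
  ∑ m, ∑ l, gInv Φ m k p * dz j (g Φ l m) p * p.2 l

/-- `δ_k f = ∂f/∂z^k - N^j_k ∂f/∂η^j`. -/
def delta {n : ℕ} (Φ : TCoord n → ℝ) (k : Fin n) (f : TCoord n → ℂ) (p : TCoord n) : ℂ :=
  dz k f p - ∑ j, N Φ j k p * deta j f p

/-- `δ_{k̄} f`, the conjugate operator of `δ_k`. -/
def deltaBar {n : ℕ} (Φ : TCoord n → ℝ) (k : Fin n) (f : TCoord n → ℂ) (p : TCoord n) : ℂ :=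
  dzBar k f p - ∑ j, conj (N Φ j k p) * detaBar j f p

/-- Horizontal coefficients of the Chern-Finsler connection, `Lc Φ i j k` being
`L^i_{jk} = g^{l̄ i} δ_k g_{j l̄}`. -/
def Lc {n : ℕ} (Φ : TCoord n → ℝ) (i j k : Fin n) (p : TCoord n) : ℂ :=
  ∑ l, gInv Φ l i p * delta Φ k (g Φ j l) p

/-- Vertical coefficients of the Chern-Finsler connection, `Cc Φ i j k` being
`C^i_{jk} = g^{l̄ i} ∂g_{j l̄}/∂η^k`. -/
def Cc {n : ℕ} (Φ : TCoord n → ℝ) (i j k : Fin n) (p : TCoord n) : ℂ :=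
  ∑ l, gInv Φ l i p * deta k (g Φ j l) p

/-- The torsion `T^i_{jk} = L^i_{jk} - L^i_{kj}`. -/
def T {n : ℕ} (Φ : TCoord n → ℝ) (i j k : Fin n) (p : TCoord n) : ℂ :=
  Lc Φ i j k p - Lc Φ i k j p

/-- The `h h̄`-curvature, `Rup Φ i j h k` being
`R^i_{j h̄ k} = - δ_{h̄} L^i_{jk} - (δ_{h̄} N^l_k) C^i_{jl}`. -/
def Rup {n : ℕ} (Φ : TCoord n → ℝ) (i j h k : Fin n) (p : TCoord n) : ℂ :=
  -deltaBar Φ h (Lc Φ i j k) p - ∑ l, deltaBar Φ h (N Φ l k) p * Cc Φ i j l p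

/-- The `h h̄`-Riemann type tensor, `R Φ r j h k` being `R_{r̄ j h̄ k} = g_{i r̄} R^i_{j h̄ k}`. -/
def R {n : ℕ} (Φ : TCoord n → ℝ) (r j h k : Fin n) (p : TCoord n) : ℂ :=
  ∑ i, g Φ i r p * Rup Φ i j h k p

/-- `l^i = η^i / F`. -/
def lUp {n : ℕ} (Φ : TCoord n → ℝ) (i : Fin n) (p : TCoord n) : ℂ := p.2 i / (Φ p : ℂ)

/-- `l_i = g_{i j̄} η̄^j / F`. -/
def lDown {n : ℕ} (Φ : TCoord n → ℝ) (i : Fin n) (p : TCoord n) : ℂ :=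
  (∑ j, g Φ i j p * conj (p.2 j)) / (Φ p : ℂ)

/-- `J = l^j l^k l_i L^i_{jk}`. -/
def J {n : ℕ} (Φ : TCoord n → ℝ) (p : TCoord n) : ℂ :=
  ∑ i, ∑ j, ∑ k, lUp Φ j p * lUp Φ k p * lDown Φ i p * Lc Φ i j k p

/-- The horizontal curvature invariant `K = -(1/F) J_{|0̄} = -(1/F) η̄^h δ_{h̄} J`. -/
def K {n : ℕ} (Φ : TCoord n → ℝ) (p : TCoord n) : ℂ :=
  -(1 / (Φ p : ℂ)) * ∑ h, conj (p.2 h) * deltaBar Φ h (J Φ) p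

/-- In dimension two, the components of the unit vector
`m = g^{-1/2} (-l_2 ∂/∂η^1 + l_1 ∂/∂η^2)`, `g = det (g_{i j̄}) > 0`, of the local complex
Berwald frame (the indices `1, 2` are here `0, 1 : Fin 2`). -/
def mUp (Φ : TCoord 2 → ℝ) (p : TCoord 2) : Fin 2 → ℂ :=
  ![-lDown Φ 1 p / (Real.sqrt (gMat Φ p).det.re : ℂ),
    lDown Φ 0 p / (Real.sqrt (gMat Φ p).det.re : ℂ)]

/-- The vertical term `A = m^j m^k l_h C^h_{kj}`. -/
def A (Φ : TCoord 2 → ℝ) (p : TCoord 2) : ℂ :=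
  ∑ j, ∑ k, ∑ h, mUp Φ p j * mUp Φ p k * lDown Φ h p * Cc Φ h k j p

/-! ## Complex Finsler spaces -/

/-- The `n`-dimensional model. -/
abbrev Model (n : ℕ) : Type := Fin n → ℂ

/-- All holomorphic charts of the complex manifold `M`. -/
abbrev charts (n : ℕ) (M : Type*) [TopologicalSpace M] [ChartedSpace (Model n) M] :
    Set (OpenPartialHomeomorph M (Model n)) :=
  IsManifold.maximalAtlas 𝓘(ℂ, Model n) ω M

/-- The local expression of `F` in the chart `e`: its value at the tangent vector
`η^k ∂/∂z^k` at the point with coordinates `z`. -/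
def localExpr {n : ℕ} {M : Type*} [TopologicalSpace M] [ChartedSpace (Model n) M]
    (F : TangentBundle 𝓘(ℂ, Model n) M → ℝ) (e : OpenPartialHomeomorph M (Model n))
    (p : TCoord n) : ℝ :=
  F ⟨e.symm p.1, mfderiv 𝓘(ℂ, Model n) 𝓘(ℂ, Model n) e.symm p.1 p.2⟩

/-- Coordinates in the chart `e` of the tangent bundle with the zero section removed. -/
def slit {n : ℕ} {M : Type*} [TopologicalSpace M] [ChartedSpace (Model n) M]
    (e : OpenPartialHomeomorph M (Model n)) : Set (TCoord n) :=
  e.target ×ˢ {η | η ≠ 0}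

/-- `(M, F)` is a complex Finsler space. The (holomorphic) tangent bundle of the complex
manifold `M` is Mathlib's tangent bundle over `ℂ`; smoothness is in the real sense. -/
structure IsComplexFinsler {n : ℕ} {M : Type*} [TopologicalSpace M] [ChartedSpace (Model n) M]
    [IsManifold 𝓘(ℂ, Model n) ω M] (F : TangentBundle 𝓘(ℂ, Model n) M → ℝ) : Prop where
  continuous : Continuous F
  smooth : ∀ e ∈ charts n M, ContDiffOn ℝ ∞ (fun p => localExpr F e p ^ 2) (slit e)
  nonneg : ∀ v, 0 ≤ F v
  eq_zero_iff : ∀ (x : M) (v : TangentSpace 𝓘(ℂ, Model n) x), F ⟨x, v⟩ = 0 ↔ v = 0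
  homogeneous : ∀ (x : M) (v : TangentSpace 𝓘(ℂ, Model n) x) (c : ℂ),
    F ⟨x, c • v⟩ = ‖c‖ * F ⟨x, v⟩
  posDef : ∀ e ∈ charts n M, ∀ p ∈ slit e, (gMat (localExpr F e) p).PosDef

/-- The weak symmetry condition `R_{0̄ k 0̄ 0} = R_{0̄ 0 0̄ k}`, an index `0` (`0̄`) denoting
contraction with `η` (`η̄`). -/
def WeaklySymmetric {n : ℕ} {M : Type*} [TopologicalSpace M] [ChartedSpace (Model n) M]
    (F : TangentBundle 𝓘(ℂ, Model n) M → ℝ) : Prop :=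
  ∀ e ∈ charts n M, ∀ p ∈ slit e, ∀ k : Fin n,
    (∑ r, ∑ h, ∑ j, R (localExpr F e) r k h j p * conj (p.2 r) * conj (p.2 h) * p.2 j) =
      ∑ r, ∑ h, ∑ j, R (localExpr F e) r j h k p * conj (p.2 r) * conj (p.2 h) * p.2 j

/-- The horizontal curvature invariant `K` is identically equal to `c`. -/
def ConstantK {n : ℕ} {M : Type*} [TopologicalSpace M] [ChartedSpace (Model n) M]
    (F : TangentBundle 𝓘(ℂ, Model n) M → ℝ) (c : ℂ) : Prop :=
  ∀ e ∈ charts n M, ∀ p ∈ slit e, K (localExpr F e) p = c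

/-- `|A| ≠ 0`, i.e. `A` is not identically zero (the metric is not purely Hermitian); the
function `|A|` does not depend on the chart. -/
def ANeZero {M : Type*} [TopologicalSpace M] [ChartedSpace (Model 2) M]
    (F : TangentBundle 𝓘(ℂ, Model 2) M → ℝ) : Prop :=
  ∃ e ∈ charts 2 M, ∃ p ∈ slit e, ‖A (localExpr F e) p‖ ≠ 0

/-- `(M, F)` is weakly Kähler: `g_{i l̄} T^i_{jk} η^j η̄^l = 0`. -/
def WeaklyKaehler {n : ℕ} {M : Type*} [TopologicalSpace M] [ChartedSpace (Model n) M]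
    (F : TangentBundle 𝓘(ℂ, Model n) M → ℝ) : Prop :=
  ∀ e ∈ charts n M, ∀ p ∈ slit e, ∀ k : Fin n,
    (∑ i, ∑ j, ∑ l, g (localExpr F e) i l p * T (localExpr F e) i j k p
      * p.2 j * conj (p.2 l)) = 0

end CFinsler

end

/-! Write `G = F²`, `X' = η̄^h δ_{h̄}` and `P = η^l ∂G/∂z^l`. Lowering the index of `L^i_{jk}` gives
`J = F⁻³ P`, and `X'` annihilates `F`, so `K = c` says exactly `-X' P = c G²`.

Differentiate this along `η^k`. The left side yields the sum of the two contracted curvatures `R_{0̄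
0 0̄ k}` and `R_{0̄ k 0̄ 0}` (`deta_X'_P`), and the first of them is `-X' (∂G/∂z^k)`
(`R₀_contract_left`). Weak symmetry makes the two equal, hence `X' (∂G/∂z^k) = -c G ∂G/∂η^k`. For
every metric, `δ_j X' (∂G/∂z^k)` is symmetric in `j, k` (`δ_X'_dz_symm`). Since `δ_j G = 0`,
applying `δ_j` gives `c G (δ_j ∂G/∂η^k - δ_k ∂G/∂η^j) = 0` (`symm_of_constant`). The factor `c G`
vanishes nowhere, and the contraction of the bracket with `η^j` is, up to sign, the weak Kähler
torsion (`torsion_contract`).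

All of this is algebra with commuting derivations, so it is done in the abstract structure
`FinslerCalculus`; `Represents` carries identities between that algebra and the coordinate
expressions. -/

noncomputable section

namespace CFinsler

open TopologicalSpace

/-! ## The algebra of smooth functions on an open set and its first order operators -/

section SmoothFn

variable {E : Type*} [NormedAddCommGroup E] [NormedSpace ℝ E]

/-- A complex combination of two directional derivatives. -/
def wd (σ : ℂ) (v w : E) (F : E → ℂ) (p : E) : ℂ :=
  (1 / 2) * (fderiv ℝ F p v + σ * fderiv ℝ F p w)

theorem wd_contDiffOn {U : Opens E} (σ : ℂ) (v w : E) {F : E → ℂ} (hF : ContDiffOn ℝ ∞ F U) :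
    ContDiffOn ℝ ∞ (wd σ v w F) U := by
  have h : ContDiffOn ℝ ∞ (fderiv ℝ F) U := hF.fderiv_of_isOpen U.isOpen (by norm_cast)
  exact contDiffOn_const.mul ((h.clm_apply contDiffOn_const).add
    (contDiffOn_const.mul (h.clm_apply contDiffOn_const)))

theorem wd_congr {U : Opens E} (σ : ℂ) (v w : E) {F F' : E → ℂ} (h : Set.EqOn F F' U) :
    Set.EqOn (wd σ v w F) (wd σ v w F') U := by
  intro p hp
  have : F =ᶠ[nhds p] F' := Filter.eventuallyEq_of_mem (U.isOpen.mem_nhds hp) h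
  simp only [wd, this.fderiv_eq]

theorem fderiv_wd (σ : ℂ) (v w : E) {F : E → ℂ} {p : E}
    (hF : DifferentiableAt ℝ (fderiv ℝ F) p) (u : E) :
    fderiv ℝ (wd σ v w F) p u =
      (1 / 2) * (fderiv ℝ (fderiv ℝ F) p u v + σ * fderiv ℝ (fderiv ℝ F) p u w) := by
  have h (v : E) : HasFDerivAt (fun q => fderiv ℝ F q v)
      ((fderiv ℝ (fderiv ℝ F) p).flip v) p := by
    simpa using hF.hasFDerivAt.clm_apply (hasFDerivAt_const v p)
  have := (((h v).add ((h w).const_mul σ)).const_mul (1 / 2 : ℂ)).fderiv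
  have e : wd σ v w F =
      fun q => (1 / 2 : ℂ) * ((fun q => fderiv ℝ F q v) + fun q => σ * fderiv ℝ F q w) q := rfl
  rw [e, this]
  simp
  ring

/-- Both sides are the same complex combination of second derivatives, which are symmetric for a
smooth function. -/
theorem wd_comm {U : Opens E} (σ τ : ℂ) (v w v' w' : E) {F : E → ℂ} (hF : ContDiffOn ℝ ∞ F U) :
    Set.EqOn (wd σ v w (wd τ v' w' F)) (wd τ v' w' (wd σ v w F)) U := by
  intro p hp
  have hat : ContDiffAt ℝ ∞ F p := hF.contDiffAt (U.isOpen.mem_nhds hp)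
  have hd : DifferentiableAt ℝ (fderiv ℝ F) p :=
    (hat.fderiv_right (m := 1) (by norm_cast)).differentiableAt (by norm_num)
  have hs : IsSymmSndFDerivAt ℝ F p := hat.isSymmSndFDerivAt (by
    rw [minSmoothness_of_isRCLikeNormedField]; exact WithTop.coe_le_coe.2 le_top)
  rw [wd, wd, fderiv_wd _ _ _ hd, fderiv_wd _ _ _ hd, fderiv_wd _ _ _ hd, fderiv_wd _ _ _ hd,
    hs.eq v v', hs.eq v w', hs.eq w v', hs.eq w w']
  ring

/-- Smooth complex functions on the open set `U`. -/
def smoothFn (U : Opens E) : Subalgebra ℂ (U → ℂ) where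
  carrier := {f | ∃ F : E → ℂ, ContDiffOn ℝ ∞ F U ∧ ∀ x : U, F x = f x}
  mul_mem' := by
    rintro f g ⟨F, hF, hf⟩ ⟨G, hG, hg⟩
    exact ⟨fun x => F x * G x, hF.mul hG, fun x => by simp [hf, hg]⟩
  add_mem' := by
    rintro f g ⟨F, hF, hf⟩ ⟨G, hG, hg⟩
    exact ⟨fun x => F x + G x, hF.add hG, fun x => by simp [hf, hg]⟩
  algebraMap_mem' c := ⟨fun _ => c, contDiffOn_const, fun _ => rfl⟩

variable {U : Opens E}

/-- The function `F` restricts to the smooth function `f` on `U`. -/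
def Represents (F : E → ℂ) (f : smoothFn U) : Prop := ∀ x : U, F x = f.1 x

namespace Represents

variable {F F' : E → ℂ} {f f' : smoothFn U}

theorem contDiffOn (h : Represents F f) : ContDiffOn ℝ ∞ F U := by
  obtain ⟨F₀, h₀, h₁⟩ := f.2
  exact h₀.congr fun x hx => (h ⟨x, hx⟩).trans (h₁ ⟨x, hx⟩).symm

theorem eqOn (h : Represents F f) (h' : Represents F' f) : Set.EqOn F F' U :=
  fun x hx => (h ⟨x, hx⟩).trans (h' ⟨x, hx⟩).symm

theorem exists_of_contDiffOn (h : ContDiffOn ℝ ∞ F U) : ∃ f : smoothFn U, Represents F f :=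
  ⟨⟨fun x => F x, F, h, fun _ => rfl⟩, fun _ => rfl⟩

theorem unique (h : Represents F f) (h' : Represents F f') : f = f' :=
  Subtype.ext <| funext fun x => (h x).symm.trans (h' x)

theorem mul (h : Represents F f) (h' : Represents F' f') :
    Represents (fun p => F p * F' p) (f * f') := fun x => by simp [h x, h' x]

theorem add (h : Represents F f) (h' : Represents F' f') :
    Represents (fun p => F p + F' p) (f + f') := fun x => by simp [h x, h' x]

theorem sub (h : Represents F f) (h' : Represents F' f') :
    Represents (fun p => F p - F' p) (f - f') := fun x => by simp [h x, h' x]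

theorem neg (h : Represents F f) : Represents (fun p => -F p) (-f) := fun x => by simp [h x]

theorem sum {ι : Type*} (s : Finset ι) {F : ι → E → ℂ} {f : ι → smoothFn U}
    (h : ∀ i, Represents (F i) (f i)) :
    Represents (fun p => ∑ i ∈ s, F i p) (∑ i ∈ s, f i) := fun x => by
  simp [fun i => h i x]

end Represents

theorem exists_represents (f : smoothFn U) : ∃ F, Represents F f := by
  obtain ⟨F, -, h⟩ := f.2
  exact ⟨F, h⟩

/-- The derivation of `smoothFn U` given by `wd`. -/
def wdDer (σ : ℂ) (v w : E) : Derivation ℂ (smoothFn U) (smoothFn U) :=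
  Derivation.mk'
    -- The chosen extension is immaterial: at a point of the open set `U`, `wd` depends only on
    -- values in `U`.
    { toFun := fun f => ⟨fun x => wd σ v w (exists_represents f).choose x, _,
        wd_contDiffOn σ v w (exists_represents f).choose_spec.contDiffOn, fun _ => rfl⟩
      map_add' := fun f f' => by
        refine Subtype.ext <| funext fun x => ?_
        have h := (exists_represents f).choose_spec
        have h' := (exists_represents f').choose_spec
        have e := wd_congr σ v w ((exists_represents (f + f')).choose_spec.eqOn (h.add h')) x.2
        refine e.trans ?_
        have hd := (h.contDiffOn.contDiffAt (U.isOpen.mem_nhds x.2)).differentiableAt (by simp)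
        have hd' := (h'.contDiffOn.contDiffAt (U.isOpen.mem_nhds x.2)).differentiableAt (by simp)
        simp only [wd, fderiv_fun_add hd hd']
        simp only [add_apply, AddMemClass.mk_add_mk, Pi.add_apply]
        ring
      map_smul' := fun c f => by
        refine Subtype.ext <| funext fun x => ?_
        have h := (exists_represents f).choose_spec
        have hc : Represents (fun p => c * (exists_represents f).choose p) (c • f) :=
          fun x => by simp [h x]
        have e := wd_congr σ v w ((exists_represents (c • f)).choose_spec.eqOn hc) x.2
        refine e.trans ?_
        have hd := (h.contDiffOn.contDiffAt (U.isOpen.mem_nhds x.2)).differentiableAt (by simp)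
        simp only [wd, fderiv_const_mul hd]
        simp
        ring }
    fun f f' => by
      refine Subtype.ext <| funext fun x => ?_
      have h := (exists_represents f).choose_spec
      have h' := (exists_represents f').choose_spec
      have e := wd_congr σ v w ((exists_represents (f * f')).choose_spec.eqOn (h.mul h')) x.2
      refine e.trans ?_
      have hd := (h.contDiffOn.contDiffAt (U.isOpen.mem_nhds x.2)).differentiableAt (by simp)
      have hd' := (h'.contDiffOn.contDiffAt (U.isOpen.mem_nhds x.2)).differentiableAt (by simp)
      simp only [wd, fderiv_fun_mul hd hd']
      simp [← h x, ← h' x]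
      ring

theorem Represents.wd {F : E → ℂ} {f : smoothFn U} (h : Represents F f) (σ : ℂ) (v w : E) :
    Represents (wd σ v w F) (wdDer σ v w f) := fun x =>
  wd_congr σ v w (h.eqOn (exists_represents f).choose_spec) x.2

theorem wdDer_comm (σ τ : ℂ) (v w v' w' : E) (f : smoothFn U) :
    wdDer σ v w (wdDer τ v' w' f) = wdDer τ v' w' (wdDer σ v w f) := by
  obtain ⟨F, h⟩ := exists_represents f
  exact Subtype.ext <| funext fun x => by
    rw [← ((h.wd τ v' w').wd σ v w) x, ← ((h.wd σ v w).wd τ v' w') x]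
    exact wd_comm σ τ v w v' w' h.contDiffOn x.2

end SmoothFn

/-! ## The Chern-Finsler calculus in the algebra of smooth functions -/

/-- The data of a complex Finsler metric in local coordinates, in terms of commuting derivations:
`d k`, `d' k`, `e k`, `e' k` play the role of `∂/∂z^k`, `∂/∂z̄^k`, `∂/∂η^k`, `∂/∂η̄^k`,
and `bar` that of complex conjugation. -/
structure FinslerCalculus (ι S : Type*) [Fintype ι] [DecidableEq ι] [CommRing S] [Algebra ℂ S]
    where
  (d d' e e' : ι → Derivation ℂ S S)
  bar : S →+* S
  (η η' : ι → S)
  G : S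
  ginv : ι → ι → S
  dz_dz (j k : ι) (f : S) : d j (d k f) = d k (d j f)
  dz_dzBar (j k : ι) (f : S) : d j (d' k f) = d' k (d j f)
  dz_deta (j k : ι) (f : S) : d j (e k f) = e k (d j f)
  dz_detaBar (j k : ι) (f : S) : d j (e' k f) = e' k (d j f)
  dzBar_deta (j k : ι) (f : S) : d' j (e k f) = e k (d' j f)
  deta_deta (j k : ι) (f : S) : e j (e k f) = e k (e j f)
  deta_detaBar (j k : ι) (f : S) : e j (e' k f) = e' k (e j f)
  dz_eta (j k : ι) : d j (η k) = 0
  dz_etaBar (j k : ι) : d j (η' k) = 0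
  dzBar_eta (j k : ι) : d' j (η k) = 0
  deta_eta (j k : ι) : e j (η k) = if k = j then 1 else 0
  deta_etaBar (j k : ι) : e j (η' k) = 0
  detaBar_eta (j k : ι) : e' j (η k) = 0
  bar_eta (k : ι) : bar (η k) = η' k
  bar_dz (k : ι) (f : S) : bar (d k f) = d' k (bar f)
  bar_deta (k : ι) (f : S) : bar (e k f) = e' k (bar f)
  bar_detaBar (k : ι) (f : S) : bar (e' k f) = e k (bar f)
  bar_G : bar G = G
  euler : ∑ k, η k * e k G = G
  ginv_mul (r l : ι) : ∑ i, e i (e' r G) * ginv l i = if r = l then 1 else 0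

namespace FinslerCalculus

variable {ι S : Type*} [Fintype ι] [DecidableEq ι] [CommRing S] [Algebra ℂ S]
  (C : FinslerCalculus ι S)

theorem derivation_sum_apply {κ : Type*} (s : Finset κ) (D : κ → Derivation ℂ S S) (f : S) :
    (∑ k ∈ s, D k) f = ∑ k ∈ s, D k f := by
  classical
  induction s using Finset.induction_on with
  | empty => simp
  | insert a s ha ih => simp [Finset.sum_insert ha, ih]

/-- `N^k_j`. -/
def N (k j : ι) : S := ∑ m, ∑ l, C.ginv m k * C.d j (C.e l (C.e' m C.G)) * C.η l

/-- `δ_k`. -/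
def δ (k : ι) : Derivation ℂ S S := C.d k - ∑ j, C.N j k • C.e j

/-- `δ_{k̄}`. -/
def δ' (k : ι) : Derivation ℂ S S := C.d' k - ∑ j, C.bar (C.N j k) • C.e' j

/-- `η̄^h δ_{h̄}`. -/
def X' : Derivation ℂ S S := ∑ h, C.η' h • C.δ' h

/-- `g_i = g_{i r̄} η̄^r`. -/
def low (i : ι) : S := ∑ r, C.e i (C.e' r C.G) * C.η' r

/-- `L^i_{jk}`. -/
def L (i j k : ι) : S := ∑ l, C.ginv l i * C.δ k (C.e j (C.e' l C.G))

/-- `C^i_{jk}`. -/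
def V (i j k : ι) : S := ∑ l, C.ginv l i * C.e k (C.e j (C.e' l C.G))

/-- `R_{0̄ j h̄ k}`. -/
def R₀ (j h k : ι) : S :=
  ∑ i, C.low i * (-C.δ' h (C.L i j k) - ∑ l, C.δ' h (C.N l k) * C.V i j l)

/-- `η^l ∂_l G`. -/
def P : S := ∑ l, C.η l * C.d l C.G

/-- `η̄^h N^{b̄}_{h̄}`. -/
def M (b : ι) : S := ∑ h, C.η' h * C.bar (C.N b h)

/-- `η̄^h ∂_{h̄}`. -/
def X₀ : Derivation ℂ S S := ∑ h, C.η' h • C.d' h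

theorem δ_apply (k : ι) (f : S) : C.δ k f = C.d k f - ∑ j, C.N j k * C.e j f := by
  simp [δ, derivation_sum_apply]

theorem δ'_apply (k : ι) (f : S) : C.δ' k f = C.d' k f - ∑ j, C.bar (C.N j k) * C.e' j f := by
  simp [δ', derivation_sum_apply]

theorem X'_apply (f : S) : C.X' f = ∑ h, C.η' h * C.δ' h f := by
  simp [X', derivation_sum_apply]

theorem X₀_apply (f : S) : C.X₀ f = ∑ h, C.η' h * C.d' h f := by
  simp [X₀, derivation_sum_apply]

/-- `X₀` commutes with `∂/∂z^j` and `∂/∂η^j`, so in this splitting every commutator with `X'` comes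
from differentiating the coefficients `M`. -/
theorem X'_eq (f : S) : C.X' f = C.X₀ f - ∑ b, C.M b * C.e' b f := by
  simp only [X'_apply, X₀_apply, δ'_apply, M, mul_sub, Finset.sum_sub_distrib, Finset.mul_sum,
    Finset.sum_mul, mul_assoc]
  congr 1
  exact Finset.sum_comm

theorem dz_X₀ (j : ι) (f : S) : C.d j (C.X₀ f) = C.X₀ (C.d j f) := by
  simp [X₀_apply, C.dz_etaBar, C.dz_dzBar]

theorem deta_X₀ (j : ι) (f : S) : C.e j (C.X₀ f) = C.X₀ (C.e j f) := by
  simp [X₀_apply, C.deta_etaBar, C.dzBar_deta]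

theorem deta_X' (k : ι) (f : S) :
    C.e k (C.X' f) = C.X' (C.e k f) - ∑ b, C.e k (C.M b) * C.e' b f := by
  simp only [X'_eq, map_sub, map_sum, Derivation.leibniz, smul_eq_mul, deta_X₀, C.deta_detaBar,
    Finset.sum_add_distrib]
  rw [sub_sub]
  simp only [mul_comm]

/-! ### Consequences of homogeneity -/

theorem euler_bar : ∑ k, C.η' k * C.e' k C.G = C.G := by
  have h := congrArg C.bar C.euler
  simpa only [map_sum, map_mul, C.bar_eta, C.bar_deta, C.bar_G] using h

/-- The conjugate Euler identity, differentiated along `η^i`, which does not see `η̄`. -/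
theorem low_eq (i : ι) : C.low i = C.e i C.G := by
  conv_rhs => rw [← C.euler_bar]
  simp [low, C.deta_etaBar, mul_comm]

theorem metric_eta (m : ι) : ∑ l, C.e l (C.e' m C.G) * C.η l = C.e' m C.G := by
  conv_rhs => rw [← C.euler]
  simp [C.detaBar_eta, mul_comm, C.deta_detaBar]

theorem deta_deta_eta (k : ι) : ∑ j, C.η j * C.e k (C.e j C.G) = 0 := by
  have h := congrArg (C.e k) C.euler
  simp only [map_sum, Derivation.leibniz, smul_eq_mul, C.deta_eta, Finset.sum_add_distrib] at h
  simpa using h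

theorem low_ginv (l : ι) : ∑ i, C.low i * C.ginv l i = C.η' l := by
  simp only [low, Finset.sum_mul]
  rw [Finset.sum_comm]
  calc _ = ∑ r, (∑ i, C.e i (C.e' r C.G) * C.ginv l i) * C.η' r := by
        simp only [Finset.sum_mul]
        exact Finset.sum_congr rfl fun _ _ => Finset.sum_congr rfl fun _ _ => by ring
    _ = _ := by simp [C.ginv_mul]

/-- Homogeneity contracts `∂g_{l m̄}/∂z^j` with `η^l` to a derivative of `∂G/∂η̄^m`; multiplying by
the metric then undoes the inverse. This is the working characterisation of `N`. -/
theorem metric_N (m j : ι) : ∑ k, C.e k (C.e' m C.G) * C.N k j = C.d j (C.e' m C.G) := by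
  have h (r : ι) : ∑ l, C.d j (C.e l (C.e' r C.G)) * C.η l = C.d j (C.e' r C.G) := by
    conv_rhs => rw [← C.metric_eta]
    simp [C.dz_eta, mul_comm]
  have hN (k : ι) : C.N k j = ∑ r, C.ginv r k * C.d j (C.e' r C.G) := by
    simp only [N, mul_assoc, ← Finset.mul_sum, h]
  simp only [hN, Finset.mul_sum]
  rw [Finset.sum_comm]
  simp only [← mul_assoc, ← Finset.sum_mul, C.ginv_mul]
  simp

theorem metric_bar_N (m j : ι) :
    ∑ k, C.e m (C.e' k C.G) * C.bar (C.N k j) = C.d' j (C.e m C.G) := by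
  have h := congrArg C.bar (C.metric_N m j)
  simpa only [map_sum, map_mul, C.bar_dz, C.bar_deta, C.bar_detaBar, C.bar_G,
    ← C.deta_detaBar] using h

/-- This is the conjugate of `metric_N`: the connection is the one making `∂G/∂η^i` constant along
`δ_{h̄}`. -/
theorem δ'_deta (h i : ι) : C.δ' h (C.e i C.G) = 0 := by
  rw [δ'_apply, ← C.metric_bar_N, sub_eq_zero]
  exact Finset.sum_congr rfl fun k _ => by rw [mul_comm, C.deta_detaBar]

theorem δ_G (k : ι) : C.δ k C.G = 0 := by
  rw [δ_apply, sub_eq_zero]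
  conv_lhs => rw [← C.euler_bar]
  simp only [map_sum, Derivation.leibniz, smul_eq_mul, C.dz_etaBar, mul_zero, add_zero,
    ← C.metric_N, ← low_eq, low, Finset.mul_sum]
  rw [Finset.sum_comm]
  exact Finset.sum_congr rfl fun _ _ => Finset.sum_congr rfl fun _ _ => by ring

theorem δ'_eta (h k : ι) : C.δ' h (C.η k) = 0 := by
  simp [δ'_apply, C.dzBar_eta, C.detaBar_eta]

theorem δ'_G (h : ι) : C.δ' h C.G = 0 := by
  conv_lhs => rw [← C.euler]
  simp [δ'_deta, δ'_eta]

theorem low_L (j k : ι) : ∑ i, C.low i * C.L i j k = C.δ k (C.e j C.G) := by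
  simp only [L, Finset.mul_sum]
  rw [Finset.sum_comm]
  simp only [← mul_assoc, ← Finset.sum_mul, low_ginv]
  conv_rhs => rw [← low_eq]
  have hη (l : ι) : C.δ k (C.η' l) = 0 := by simp [δ_apply, C.dz_etaBar, C.deta_etaBar]
  simp [low, hη]

theorem low_V (j k : ι) : ∑ i, C.low i * C.V i j k = C.e k (C.e j C.G) := by
  simp only [V, Finset.mul_sum]
  rw [Finset.sum_comm]
  simp only [← mul_assoc, ← Finset.sum_mul, low_ginv]
  conv_rhs => rw [← low_eq]
  simp [low, C.deta_etaBar]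

theorem eta_δ_deta (k : ι) : ∑ j, C.η j * C.δ k (C.e j C.G) = C.d k C.G := by
  simp only [δ_apply, mul_sub, Finset.sum_sub_distrib, Finset.mul_sum]
  rw [Finset.sum_comm]
  have h (y : ι) : ∑ x, C.η x * (C.N y k * C.e y (C.e x C.G)) = 0 := by
    rw [← mul_zero (C.N y k), ← C.deta_deta_eta y, Finset.mul_sum]
    exact Finset.sum_congr rfl fun _ _ => by ring
  simp only [h, Finset.sum_const_zero, sub_zero]
  conv_rhs => rw [← C.euler]
  simp [C.dz_eta]

/-! ### Curvature -/

/-- The factor `g_i = ∂G/∂η^i` is killed by `δ_{h̄}`, so it can be moved inside the derivative and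
used to lower `L` and `V`. -/
theorem R₀_eq (j h k : ι) : C.R₀ j h k =
    -C.δ' h (C.δ k (C.e j C.G)) - ∑ l, C.δ' h (C.N l k) * C.e l (C.e j C.G) := by
  rw [← low_L]
  simp only [R₀, ← low_V, map_sum, Derivation.leibniz, smul_eq_mul, mul_sub, mul_neg,
    Finset.sum_sub_distrib, Finset.sum_add_distrib, Finset.sum_neg_distrib, Finset.mul_sum]
  simp only [low_eq, δ'_deta, mul_zero, Finset.sum_const_zero, add_zero]
  congr 1
  rw [Finset.sum_comm]
  exact Finset.sum_congr rfl fun _ _ => Finset.sum_congr rfl fun _ _ => by ring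

/-- `R_{0̄ 0 0̄ k}`. -/
theorem R₀_contract_left (k : ι) :
    ∑ h, ∑ j, C.R₀ j h k * C.η' h * C.η j = -C.X' (C.d k C.G) := by
  rw [X'_apply, ← Finset.sum_neg_distrib]
  refine Finset.sum_congr rfl fun h _ => ?_
  -- The vertical term drops out because `∂G/∂η^l` has degree zero in `η`.
  have h1 (l : ι) : ∑ j, C.η j * (C.δ' h (C.N l k) * C.e l (C.e j C.G)) = 0 := by
    rw [← mul_zero (C.δ' h (C.N l k)), ← C.deta_deta_eta l, Finset.mul_sum]
    exact Finset.sum_congr rfl fun _ _ => by ring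
  calc _ = -(C.η' h * ∑ j, C.η j * C.δ' h (C.δ k (C.e j C.G)))
        - C.η' h * ∑ l, ∑ j, C.η j * (C.δ' h (C.N l k) * C.e l (C.e j C.G)) := by
        rw [Finset.sum_comm (f := fun l j => C.η j * (C.δ' h (C.N l k) * C.e l (C.e j C.G)))]
        rw [← mul_neg, ← mul_sub, ← Finset.sum_neg_distrib, ← Finset.sum_sub_distrib,
          Finset.mul_sum]
        refine Finset.sum_congr rfl fun j _ => ?_
        rw [R₀_eq, ← Finset.mul_sum]
        ring
    _ = _ := by
        rw [← eta_δ_deta]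
        simp [h1, δ'_eta]

theorem X'_dz_deta (l k : ι) : C.X' (C.d l (C.e k C.G)) = C.X' (C.δ l (C.e k C.G)) +
    ∑ m, C.X' (C.N m l) * C.e m (C.e k C.G) + ∑ m, C.N m l * C.X' (C.e m (C.e k C.G)) := by
  have h : C.d l (C.e k C.G) = C.δ l (C.e k C.G) + ∑ m, C.N m l * C.e m (C.e k C.G) := by
    rw [δ_apply]; ring
  rw [h, map_add, map_sum, add_assoc, ← Finset.sum_add_distrib]
  simp only [Derivation.leibniz, smul_eq_mul]
  congr 1
  exact Finset.sum_congr rfl fun _ _ => by ring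

/-- `R_{0̄ k 0̄ 0}`. -/
theorem R₀_contract_right (k : ι) :
    ∑ h, ∑ j, C.R₀ k h j * C.η' h * C.η j = -∑ l, C.η l * (C.X' (C.δ l (C.e k C.G)) +
      ∑ m, C.X' (C.N m l) * C.e m (C.e k C.G)) := by
  rw [Finset.sum_comm, ← Finset.sum_neg_distrib]
  refine Finset.sum_congr rfl fun l _ => ?_
  simp only [R₀_eq, X'_apply, Finset.sum_mul]
  rw [Finset.sum_comm (s := Finset.univ (α := ι)) (f := fun m h => C.η' h * _ * _),
    ← Finset.sum_add_distrib, Finset.mul_sum, ← Finset.sum_neg_distrib]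
  refine Finset.sum_congr rfl fun h _ => ?_
  simp only [mul_assoc, ← Finset.mul_sum]
  ring

theorem X'_deta (k : ι) : C.X' (C.e k C.G) = 0 := by
  simp [X'_apply, δ'_deta]

/-- Since `X'` kills `∂G/∂η^m`, only the commutator of `∂/∂η^k` with `X'` remains. -/
theorem X'_deta_deta (k m : ι) :
    C.X' (C.e m (C.e k C.G)) = ∑ b, C.e k (C.M b) * C.e m (C.e' b C.G) := by
  have h := C.deta_X' k (C.e m C.G)
  rw [X'_deta, map_zero, eq_comm, sub_eq_zero, C.deta_deta k m] at h
  simpa only [C.deta_detaBar] using h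

theorem X'_eta (k : ι) : C.X' (C.η k) = 0 := by simp [X'_apply, δ'_eta]

theorem deta_P (k : ι) : C.e k C.P = C.d k C.G + ∑ l, C.η l * C.d l (C.e k C.G) := by
  simp only [P, map_sum, Derivation.leibniz, smul_eq_mul, C.deta_eta, Finset.sum_add_distrib,
    C.dz_deta]
  simp [add_comm]

theorem detaBar_P (b : ι) :
    C.e' b C.P = ∑ l, C.η l * ∑ m, C.e m (C.e' b C.G) * C.N m l := by
  simp [P, C.detaBar_eta, metric_N, C.dz_detaBar]

/-- The fibre derivative of the holomorphic curvature. -/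
theorem deta_X'_P (k : ι) : -C.e k (C.X' C.P) =
    ∑ h, ∑ j, C.R₀ j h k * C.η' h * C.η j + ∑ h, ∑ j, C.R₀ k h j * C.η' h * C.η j := by
  -- The left side arises in expanding `X' (∂P/∂η^k)`, the right side is the commutator correction
  -- from `deta_X'`; their cancellation leaves only curvature.
  have h1 : ∑ l, C.η l * ∑ m, C.N m l * C.X' (C.e m (C.e k C.G)) =
      ∑ b, C.e k (C.M b) * C.e' b C.P := by
    simp only [X'_deta_deta, detaBar_P, Finset.mul_sum]
    rw [eq_comm, Finset.sum_comm]
    refine Finset.sum_congr rfl fun l _ => ?_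
    rw [Finset.sum_comm]
    exact Finset.sum_congr rfl fun _ _ => Finset.sum_congr rfl fun _ _ => by ring
  have h2 : C.X' (C.e k C.P) = C.X' (C.d k C.G) + ∑ l, C.η l * (C.X' (C.δ l (C.e k C.G)) +
      ∑ m, C.X' (C.N m l) * C.e m (C.e k C.G)) + ∑ b, C.e k (C.M b) * C.e' b C.P := by
    rw [deta_P, map_add, map_sum, ← h1, add_assoc, ← Finset.sum_add_distrib]
    congr 1
    refine Finset.sum_congr rfl fun l _ => ?_
    simp only [Derivation.leibniz, smul_eq_mul, X'_eta, mul_zero, add_zero, X'_dz_deta]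
    ring
  rw [deta_X', h2, R₀_contract_left, R₀_contract_right]
  ring

/-- The point is to eliminate the derivatives `δ_j M`, leaving an expression whose behaviour under
exchanging `j` and `k` is visible. -/
theorem δ_X'_dz (j k : ι) : C.δ j (C.X' (C.d k C.G)) = C.X' (C.d j (C.d k C.G))
      - ∑ i, C.N i j * C.X' (C.e i (C.d k C.G)) - ∑ m, C.N m k * C.X' (C.d j (C.e m C.G))
      + ∑ m, ∑ i, C.N m k * C.N i j * C.X' (C.e i (C.e m C.G)) := by
  have hcomm (f : S) : C.δ j (C.X' f) = C.X' (C.d j f) - ∑ i, C.N i j * C.X' (C.e i f)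
      - ∑ b, C.δ j (C.M b) * C.e' b f := by
    have h0 : ∑ b, C.M b * C.δ j (C.e' b f) = ∑ b, C.M b * C.e' b (C.d j f)
        - ∑ i, C.N i j * ∑ b, C.M b * C.e' b (C.e i f) := by
      simp only [δ_apply, C.dz_detaBar, C.deta_detaBar, mul_sub, Finset.sum_sub_distrib,
        Finset.mul_sum]
      congr 1
      rw [Finset.sum_comm]
      exact Finset.sum_congr rfl fun _ _ => Finset.sum_congr rfl fun _ _ => by ring
    have h1 : C.δ j (C.X' f) = C.δ j (C.X₀ f) - ∑ b, C.M b * C.δ j (C.e' b f)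
        - ∑ b, C.δ j (C.M b) * C.e' b f := by
      simp only [X'_eq, map_sub, map_sum, Derivation.leibniz, smul_eq_mul,
        Finset.sum_add_distrib, mul_comm (C.δ j (C.M _))]
      ring
    rw [h1, h0, δ_apply]
    simp only [dz_X₀, deta_X₀, X'_eq, mul_sub, Finset.sum_sub_distrib]
    ring
  -- For `f = ∂G/∂η^m` the left side of `hcomm` is zero, so `hcomm` can be solved for the unknown
  -- correction.
  have hM (m : ι) : ∑ b, C.δ j (C.M b) * C.e' b (C.e m C.G) =
      C.X' (C.d j (C.e m C.G)) - ∑ i, C.N i j * C.X' (C.e i (C.e m C.G)) := by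
    have h := hcomm (C.e m C.G)
    rw [X'_deta, map_zero, eq_comm, sub_eq_zero] at h
    exact h.symm
  -- By `metric_N` the correction for `∂G/∂z^k` is an `N`-combination of those just found.
  have hk : ∑ b, C.δ j (C.M b) * C.e' b (C.d k C.G) =
      ∑ m, C.N m k * ∑ b, C.δ j (C.M b) * C.e' b (C.e m C.G) := by
    simp only [← C.dz_detaBar, ← metric_N, Finset.mul_sum, C.deta_detaBar]
    rw [Finset.sum_comm]
    exact Finset.sum_congr rfl fun _ _ => Finset.sum_congr rfl fun _ _ => by ring
  rw [hcomm, hk]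
  simp only [hM, mul_sub, Finset.sum_sub_distrib, Finset.mul_sum, mul_assoc]
  ring

/-- In `δ_X'_dz` the two single sums are exchanged, and the other terms are symmetric because the
derivations commute. -/
theorem δ_X'_dz_symm (j k : ι) :
    C.δ j (C.X' (C.d k C.G)) = C.δ k (C.X' (C.d j C.G)) := by
  have h : ∑ m, ∑ i, C.N m k * C.N i j * C.X' (C.e i (C.e m C.G)) =
      ∑ m, ∑ i, C.N m j * C.N i k * C.X' (C.e i (C.e m C.G)) := by
    rw [Finset.sum_comm]
    refine Finset.sum_congr rfl fun m _ => Finset.sum_congr rfl fun i _ => ?_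
    rw [C.deta_deta, mul_comm (C.N i k)]
  rw [δ_X'_dz, δ_X'_dz, C.dz_dz j k, h]
  simp only [C.dz_deta]
  ring

/-- Constant holomorphic curvature and weak symmetry force the horizontal derivatives of
`∂G/∂η^k` to be symmetric, up to the factor `c G`. -/
theorem symm_of_constant (c : ℂ) (hK : -C.X' C.P = algebraMap ℂ S c * (C.G * C.G))
    (hsymm : ∀ k, ∑ h, ∑ j, C.R₀ k h j * C.η' h * C.η j = ∑ h, ∑ j, C.R₀ j h k * C.η' h * C.η j)
    (j k : ι) : algebraMap ℂ S c * (C.G * (C.δ j (C.e k C.G) - C.δ k (C.e j C.G))) = 0 := by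
  -- Division by 2 in `S` is available through its `ℂ`-algebra structure.
  have h2 : (algebraMap ℂ S (1 / 2)) * 2 = 1 := by
    rw [show (2 : S) = algebraMap ℂ S 2 from (map_ofNat _ 2).symm, ← map_mul]
    norm_num
  -- Weak symmetry doubles one contracted curvature, and `∂(G²)/∂η^k` carries the same factor 2.
  have hX (k : ι) : C.X' (C.d k C.G) = -(algebraMap ℂ S c * (C.G * C.e k C.G)) := by
    have h := congrArg (C.e k) hK
    rw [map_neg, deta_X'_P, hsymm, R₀_contract_left] at h
    simp only [Derivation.leibniz, smul_eq_mul, Derivation.map_algebraMap, mul_zero, add_zero] at h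
    linear_combination (-algebraMap ℂ S (1 / 2)) * h
      - (C.X' (C.d k C.G) + algebraMap ℂ S c * (C.G * C.e k C.G)) * h2
  have h := C.δ_X'_dz_symm j k
  rw [hX, hX] at h
  simp only [map_neg, Derivation.leibniz, smul_eq_mul, Derivation.map_algebraMap, mul_zero,
    add_zero, δ_G] at h
  linear_combination -h

/-- The contracted torsion `g_{i l̄} T^i_{jk} η^j η̄^l`. -/
theorem torsion_contract (k : ι) :
    ∑ i, ∑ j, ∑ l, C.e i (C.e' l C.G) * (C.L i j k - C.L i k j) * C.η j * C.η' l =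
      ∑ j, C.η j * (C.δ k (C.e j C.G) - C.δ j (C.e k C.G)) := by
  rw [Finset.sum_comm]
  refine Finset.sum_congr rfl fun j _ => ?_
  rw [← low_L, ← low_L, ← Finset.sum_sub_distrib, Finset.mul_sum]
  refine Finset.sum_congr rfl fun i _ => ?_
  rw [← mul_sub, low, Finset.sum_mul, Finset.mul_sum]
  exact Finset.sum_congr rfl fun _ _ => by ring

end FinslerCalculus

/-! ## The calculus of a metric function in local coordinates -/

section Operators

variable {n : ℕ}

theorem dz_eq_wd (k : Fin n) :
    dz k = wd (-Complex.I) (Pi.single k 1, 0) (Pi.single k Complex.I, 0) := by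
  funext F p
  simp only [dz, wd]
  ring

theorem deta_eq_wd (k : Fin n) :
    deta k = wd (-Complex.I) (0, Pi.single k 1) (0, Pi.single k Complex.I) := by
  funext F p
  simp only [deta, wd]
  ring

variable {U : Opens (TCoord n)}

/-- `dz` as a derivation. -/
def dzDer (k : Fin n) : Derivation ℂ (smoothFn U) (smoothFn U) :=
  wdDer (-Complex.I) (Pi.single k 1, 0) (Pi.single k Complex.I, 0)

/-- `dzBar` as a derivation. -/
def dzBarDer (k : Fin n) : Derivation ℂ (smoothFn U) (smoothFn U) :=
  wdDer Complex.I (Pi.single k 1, 0) (Pi.single k Complex.I, 0)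

/-- `deta` as a derivation. -/
def detaDer (k : Fin n) : Derivation ℂ (smoothFn U) (smoothFn U) :=
  wdDer (-Complex.I) (0, Pi.single k 1) (0, Pi.single k Complex.I)

/-- `detaBar` as a derivation. -/
def detaBarDer (k : Fin n) : Derivation ℂ (smoothFn U) (smoothFn U) :=
  wdDer Complex.I (0, Pi.single k 1) (0, Pi.single k Complex.I)

namespace Represents

variable {F : TCoord n → ℂ} {f : smoothFn U} (h : Represents F f)
include h

theorem dz (k : Fin n) : Represents (dz k F) (dzDer k f) := by
  rw [dz_eq_wd]; exact h.wd _ _ _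

theorem dzBar (k : Fin n) : Represents (dzBar k F) (dzBarDer k f) := h.wd _ _ _

theorem deta (k : Fin n) : Represents (deta k F) (detaDer k f) := by
  rw [deta_eq_wd]; exact h.wd _ _ _

theorem detaBar (k : Fin n) : Represents (detaBar k F) (detaBarDer k f) := h.wd _ _ _

end Represents

/-- The directions `v, w` are real, so conjugation affects only `σ` and the values of `F`. -/
theorem conj_wd {E : Type*} [NormedAddCommGroup E] [NormedSpace ℝ E] (σ : ℂ) (v w : E)
    (F : E → ℂ) (p : E) : conj (wd σ v w F p) = wd (conj σ) v w (fun q => conj (F q)) p := by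
  have h : fderiv ℝ (fun q => conj (F q)) p =
      Complex.conjCLE.toContinuousLinearMap.comp (fderiv ℝ F p) :=
    Complex.conjCLE.comp_fderiv
  simp [wd, h, map_ofNat (starRingEnd ℂ) 2]

end Operators

section Conj

variable {E : Type*} [NormedAddCommGroup E] [NormedSpace ℝ E] {U : Opens E}

theorem contDiffOn_conj {F : E → ℂ} {s : Set E} (hF : ContDiffOn ℝ ∞ F s) :
    ContDiffOn ℝ ∞ (fun p => conj (F p)) s :=
  Complex.conjCLE.contDiff.comp_contDiffOn hF

/-- Complex conjugation of smooth functions. -/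
def conjHom : smoothFn U →+* smoothFn U where
  toFun f := ⟨fun x => conj (f.1 x), fun p => conj ((exists_represents f).choose p),
    contDiffOn_conj (exists_represents f).choose_spec.contDiffOn,
    fun x => congrArg _ ((exists_represents f).choose_spec x)⟩
  map_one' := Subtype.ext <| funext fun x => by simp
  map_zero' := Subtype.ext <| funext fun x => by simp
  map_add' f g := Subtype.ext <| funext fun x => by simp
  map_mul' f g := Subtype.ext <| funext fun x => by simp

theorem Represents.conj {F : E → ℂ} {f : smoothFn U} (h : Represents F f) :
    Represents (fun p => conj (F p)) (conjHom f) := fun x => congrArg _ (h x)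

theorem conjHom_wdDer (σ : ℂ) (v w : E) (f : smoothFn U) :
    conjHom (wdDer σ v w f) = wdDer (conj σ) v w (conjHom f) := by
  obtain ⟨F, h⟩ := exists_represents f
  refine (h.wd σ v w).conj.unique ?_
  simp only [conj_wd]
  exact h.conj.wd _ v w

end Conj

/-! ### Fibre coordinates and their derivatives -/

section Coordinates

variable {n : ℕ} {U : Opens (TCoord n)}

/-- The fibre coordinate `η^k` as a continuous linear form. -/
def etaForm (k : Fin n) : TCoord n →L[ℝ] ℂ :=
  (ContinuousLinearMap.proj k).comp (ContinuousLinearMap.snd ℝ (Fin n → ℂ) (Fin n → ℂ))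

/-- The fibre coordinate `η^k` as a smooth function. -/
def etaFn (U : Opens (TCoord n)) (k : Fin n) : smoothFn U :=
  ⟨fun x => x.1.2 k, fun p => p.2 k, (etaForm k).contDiff.contDiffOn, fun _ => rfl⟩

theorem represents_eta (k : Fin n) : Represents (fun p => p.2 k) (etaFn U k) := fun _ => rfl

theorem wdDer_form (σ : ℂ) (v w : TCoord n) (A : TCoord n →L[ℝ] ℂ) {f : smoothFn U}
    (hf : Represents A f) :
    wdDer σ v w f = algebraMap ℂ (smoothFn U) ((1 / 2) * (A v + σ * A w)) := by
  refine (hf.wd σ v w).unique fun x => ?_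
  simp only [wd, A.fderiv]
  rfl

theorem wdDer_eta (σ : ℂ) (v w : TCoord n) (k : Fin n) :
    wdDer σ v w (etaFn U k) =
      algebraMap ℂ (smoothFn U) ((1 / 2) * (v.2 k + σ * w.2 k)) :=
  wdDer_form σ v w (etaForm k) (represents_eta k)

theorem wdDer_conj_eta (σ : ℂ) (v w : TCoord n) (k : Fin n) :
    wdDer σ v w (conjHom (etaFn U k)) =
      algebraMap ℂ (smoothFn U) ((1 / 2) * (conj (v.2 k) + σ * conj (w.2 k))) :=
  wdDer_form σ v w (Complex.conjCLE.toContinuousLinearMap.comp (etaForm k))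
    (represents_eta k).conj

end Coordinates

/-- The local properties of a complex Finsler metric on an open set of coordinates. -/
structure IsLocalMetric {n : ℕ} (U : Opens (TCoord n)) (Φ : TCoord n → ℝ) : Prop where
  smooth : ContDiffOn ℝ ∞ (fun p => Φ p ^ 2) U
  nonneg : ∀ p, 0 ≤ Φ p
  homogeneous : ∀ p ∈ U, ∀ c : ℂ, Φ (p.1, c • p.2) = ‖c‖ * Φ p
  posDef : ∀ p ∈ U, (gMat Φ p).PosDef

/-! ### Euler's identity from homogeneity -/

namespace IsLocalMetric

variable {n : ℕ} {U : Opens (TCoord n)} {Φ : TCoord n → ℝ} (h : IsLocalMetric U Φ)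
include h

theorem contDiffOn_Lfun : ContDiffOn ℝ ∞ (Lfun Φ) U :=
  Complex.ofRealCLM.contDiff.comp_contDiffOn h.smooth

/-- Along `t ↦ η + t a η` homogeneity gives `L` multiplied by `|1 + t a|²`, whose derivative at `0`
is `2 Re a`. -/
theorem fderiv_vertical {p : TCoord n} (hp : p ∈ U) (a : ℂ) :
    fderiv ℝ (Lfun Φ) p (0, a • p.2) = 2 * a.re * Lfun Φ p := by
  have hd : DifferentiableAt ℝ (Lfun Φ) p :=
    (h.contDiffOn_Lfun.contDiffAt (U.isOpen.mem_nhds hp)).differentiableAt (by simp)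
  have hl : HasDerivAt (fun t : ℝ => p + t • ((0, a • p.2) : TCoord n)) (0, a • p.2) 0 := by
    simpa using ((hasDerivAt_id (0 : ℝ)).smul_const ((0, a • p.2) : TCoord n)).const_add p
  have h1 : HasDerivAt (fun t : ℝ => Lfun Φ (p + t • ((0, a • p.2) : TCoord n)))
      (fderiv ℝ (Lfun Φ) p (0, a • p.2)) 0 := by
    have : HasFDerivAt (Lfun Φ) (fderiv ℝ (Lfun Φ) p)
        (p + (0 : ℝ) • ((0, a • p.2) : TCoord n)) := by
      simpa using hd.hasFDerivAt
    exact this.comp_hasDerivAt (0 : ℝ) hl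
  have h2 (t : ℝ) : Lfun Φ (p + t • ((0, a • p.2) : TCoord n)) =
      ((((1 + t * a.re) ^ 2 + (t * a.im) ^ 2 : ℝ)) : ℂ) * Lfun Φ p := by
    have e : p + t • ((0, a • p.2) : TCoord n) = (p.1, (1 + t * a : ℂ) • p.2) := by
      ext i <;> simp [add_mul, mul_assoc]
    have en : ‖(1 + t * a : ℂ)‖ ^ 2 = (1 + t * a.re) ^ 2 + (t * a.im) ^ 2 := by
      rw [Complex.sq_norm, Complex.normSq_apply]
      simp
      ring
    rw [e, Lfun, Lfun, h.homogeneous p hp, mul_pow, en]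
    push_cast
    rfl
  simp only [h2] at h1
  have h3 : HasDerivAt (fun t : ℝ => (1 + t * a.re) ^ 2 + (t * a.im) ^ 2) (2 * a.re) 0 := by
    have e1 := (((hasDerivAt_id (0 : ℝ)).mul_const a.re).const_add 1).pow 2
    have e2 := ((hasDerivAt_id (0 : ℝ)).mul_const a.im).pow 2
    exact (e1.add e2).congr_deriv (by simp)
  have h4 := h3.ofReal_comp.mul_const (Lfun Φ p)
  rw [h1.unique h4]
  push_cast
  rfl

/-- The holomorphic radial derivative combines the real derivatives along `η` and `i η`, that is, `a
= 1` and `a = I` in `fderiv_vertical`. -/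
theorem euler {p : TCoord n} (hp : p ∈ U) : ∑ k, p.2 k * deta k (Lfun Φ) p = Lfun Φ p := by
  set A := fderiv ℝ (Lfun Φ) p
  have hv (v : Fin n → ℂ) : A (0, v) =
      ∑ k, ((v k).re * A (0, Pi.single k 1) + (v k).im * A (0, Pi.single k Complex.I)) := by
    have e : ((0, v) : TCoord n) = ∑ k, ((v k).re • ((0, Pi.single k 1) : TCoord n)
        + (v k).im • ((0, Pi.single k Complex.I) : TCoord n)) := by
      refine Prod.ext ?_ ?_
      · simp [Prod.fst_sum]
      · funext i
        simp [Prod.snd_sum, Finset.sum_apply, Pi.single_apply, Finset.sum_add_distrib]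
    rw [e, map_sum]
    simp only [map_add, map_smul, Complex.real_smul]
  have h1 := h.fderiv_vertical hp 1
  have h2 := h.fderiv_vertical hp Complex.I
  rw [hv] at h1 h2
  have : ∑ k, p.2 k * deta k (Lfun Φ) p = (1 / 2) * ((2 * (1 : ℂ).re * Lfun Φ p)
      - Complex.I * (2 * Complex.I.re * Lfun Φ p)) := by
    rw [← h1, ← h2, Finset.mul_sum, ← Finset.sum_sub_distrib, Finset.mul_sum]
    refine Finset.sum_congr rfl fun k _ => ?_
    simp only [deta, Pi.smul_apply, smul_eq_mul, one_mul, Complex.I_mul_re, Complex.I_mul_im]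
    conv_lhs => rw [← Complex.re_add_im (p.2 k)]
    push_cast
    linear_combination (-(1 / 2) * A (0, Pi.single k Complex.I) * (p.2 k).im) * Complex.I_sq
  rw [this]
  simp

end IsLocalMetric

/-! ### Reduction of `K` to `X' P` -/

namespace FinslerCalculus

variable {ι S : Type*} [Fintype ι] [DecidableEq ι] [CommRing S] [Algebra ℂ S]
  (C : FinslerCalculus ι S)

/-- The contraction `ψ³ η^j η^k g_i L^i_{jk}`, which is `J` when `ψ = 1 / F`. -/
theorem sum_low_L (ψ : S) :
    ∑ i, ∑ j, ∑ k, C.η j * ψ * (C.η k * ψ) * (C.low i * ψ) * C.L i j k = ψ ^ 3 * C.P := by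
  simp only [P, ← eta_δ_deta, ← low_L, Finset.mul_sum]
  rw [Finset.sum_comm]
  conv_lhs => enter [2, j]; rw [Finset.sum_comm]
  rw [Finset.sum_comm]
  refine Finset.sum_congr rfl fun k _ => Finset.sum_congr rfl fun j _ =>
    Finset.sum_congr rfl fun i _ => ?_
  ring

/-- If `φ² = G` and `ψ = 1 / φ`, then `X' (ψ³ P) = ψ³ X' P`. -/
theorem X'_inv_cube_mul {φ ψ : S} (hφ : φ * φ = C.G) (hψ : φ * ψ = 1) (f : S) :
    C.X' (ψ ^ 3 * f) = ψ ^ 3 * C.X' f := by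
  have h2 : (algebraMap ℂ S (1 / 2)) * 2 = 1 := by
    rw [show (2 : S) = algebraMap ℂ S 2 from (map_ofNat _ 2).symm, ← map_mul]
    norm_num
  have hG : C.X' C.G = 0 := by simp [X'_apply, δ'_G]
  -- Differentiate `φ² = G` and cancel the invertible factor `2 φ`.
  have h1 : C.X' φ = 0 := by
    have h := congrArg C.X' hφ
    simp only [hG, Derivation.leibniz, smul_eq_mul] at h
    linear_combination algebraMap ℂ S (1 / 2) * ψ * h - C.X' φ * h2
      - 2 * algebraMap ℂ S (1 / 2) * C.X' φ * hψ
  have h3 : C.X' ψ = 0 := by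
    have h := congrArg C.X' hψ
    simp only [h1, Derivation.leibniz, smul_eq_mul, mul_zero, add_zero, Derivation.map_one_eq_zero]
      at h
    linear_combination ψ * h - C.X' ψ * hψ
  simp [Derivation.leibniz, Derivation.leibniz_pow, h3]

end FinslerCalculus

theorem contDiffOn_det {E : Type*} [NormedAddCommGroup E] [NormedSpace ℝ E] {s : Set E} {n : ℕ}
    {B : E → Matrix (Fin n) (Fin n) ℂ} (hB : ∀ i j, ContDiffOn ℝ ∞ (fun p => B p i j) s) :
    ContDiffOn ℝ ∞ (fun p => (B p).det) s := by
  simp only [Matrix.det_apply']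
  exact ContDiffOn.sum fun σ _ => contDiffOn_const.mul (contDiffOn_prod fun i _ => hB _ _)

namespace IsLocalMetric

variable {n : ℕ} {U : Opens (TCoord n)} {Φ : TCoord n → ℝ} (h : IsLocalMetric U Φ)

/-- `L` as a smooth function. -/
def energy : smoothFn U := ⟨fun x => Lfun Φ x, Lfun Φ, h.contDiffOn_Lfun, fun _ => rfl⟩

theorem represents_energy : Represents (Lfun Φ) h.energy := fun _ => rfl

theorem represents_metric (i j : Fin n) :
    Represents (g Φ i j) (detaDer i (detaBarDer j h.energy)) :=
  (h.represents_energy.detaBar j).deta i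

include h in
theorem det_ne_zero {p : TCoord n} (hp : p ∈ U) : (gMat Φ p).det ≠ 0 :=
  (h.posDef p hp).det_pos.ne'

include h in
theorem contDiffOn_gInv (m k : Fin n) : ContDiffOn ℝ ∞ (gInv Φ m k) U := by
  have hg (i j : Fin n) : ContDiffOn ℝ ∞ (fun p => gMat Φ p i j) U :=
    (h.represents_metric i j).contDiffOn
  -- Cramer's rule reduces smoothness of the inverse to that of determinants.
  have e : gInv Φ m k =
      fun p => ((gMat Φ p).det)⁻¹ * ((gMat Φ p).updateRow k (Pi.single m 1)).det := by
    funext p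
    simp [gInv, Matrix.inv_def, Matrix.adjugate_apply, Ring.inverse_eq_inv']
  rw [e]
  refine ((contDiffOn_det hg).inv fun p hp => h.det_ne_zero hp).mul (contDiffOn_det fun i j => ?_)
  by_cases hi : i = k
  · subst hi
    simpa using contDiffOn_const
  · simpa [Matrix.updateRow_ne hi] using hg i j

/-- The inverse metric as smooth functions. -/
def inverseMetric (m k : Fin n) : smoothFn U :=
  ⟨fun x => gInv Φ m k x, gInv Φ m k, h.contDiffOn_gInv m k, fun _ => rfl⟩

theorem represents_inverseMetric (m k : Fin n) : Represents (gInv Φ m k) (h.inverseMetric m k) :=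
  fun _ => rfl

/-- The Chern-Finsler calculus of a local metric. -/
def calculus : FinslerCalculus (Fin n) (smoothFn U) where
  d := dzDer
  d' := dzBarDer
  e := detaDer
  e' := detaBarDer
  bar := conjHom
  η := etaFn U
  η' k := conjHom (etaFn U k)
  G := h.energy
  ginv := h.inverseMetric
  dz_dz _ _ _ := wdDer_comm ..
  dz_dzBar _ _ _ := wdDer_comm ..
  dz_deta _ _ _ := wdDer_comm ..
  dz_detaBar _ _ _ := wdDer_comm ..
  dzBar_deta _ _ _ := wdDer_comm ..
  deta_deta _ _ _ := wdDer_comm ..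
  deta_detaBar _ _ _ := wdDer_comm ..
  dz_eta j k := by simp [dzDer, wdDer_eta]
  dz_etaBar j k := by simp [dzDer, wdDer_conj_eta]
  dzBar_eta j k := by simp [dzBarDer, wdDer_eta]
  deta_eta j k := by
    rw [detaDer, wdDer_eta]
    by_cases hk : k = j
    · subst hk
      rw [if_pos rfl, ← map_one (algebraMap ℂ (smoothFn U))]
      congr 1
      simp
      norm_num
    · simp [hk]
  deta_etaBar j k := by
    rw [detaDer, wdDer_conj_eta, ← map_zero (algebraMap ℂ (smoothFn U))]
    by_cases hk : k = j
    · subst hk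
      simp
    · simp [hk]
  detaBar_eta j k := by
    rw [detaBarDer, wdDer_eta, ← map_zero (algebraMap ℂ (smoothFn U))]
    by_cases hk : k = j
    · subst hk
      simp
    · simp [hk]
  bar_eta _ := rfl
  bar_dz k f := by simp [dzDer, dzBarDer, conjHom_wdDer]
  bar_deta k f := by simp [detaDer, detaBarDer, conjHom_wdDer]
  bar_detaBar k f := by simp [detaDer, detaBarDer, conjHom_wdDer]
  bar_G := Subtype.ext <| funext fun x => Complex.conj_ofReal _
  euler := (Represents.sum _ fun k =>
      (represents_eta k).mul (h.represents_energy.deta k)).unique fun x => h.euler x.2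
  ginv_mul r l := by
    refine (Represents.sum _ fun i =>
      (h.represents_metric i r).mul (h.represents_inverseMetric l i)).unique fun x => ?_
    -- With these index positions the sum is the `(l, r)` entry of inverse times metric, so the
    -- left-inverse identity is the one needed.
    have e := congrFun (congrFun (Matrix.nonsing_inv_mul (gMat Φ x.1)
      (isUnit_iff_ne_zero.2 (h.det_ne_zero x.2))) l) r
    rw [Matrix.mul_apply, Matrix.one_apply] at e
    have e' : ∑ i, g Φ i r x.1 * gInv Φ l i x.1 = if l = r then 1 else 0 := by
      rw [← e]
      exact Finset.sum_congr rfl fun _ _ => mul_comm _ _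
    refine e'.trans ?_
    by_cases hr : r = l
    · simp [hr]
    · simp [hr, Ne.symm hr]

end IsLocalMetric

/-! ### Dictionary between coordinate tensors and the calculus -/

namespace Represents

variable {n : ℕ} {U : Opens (TCoord n)} {Φ : TCoord n → ℝ} (h : IsLocalMetric U Φ)

theorem metric (i j : Fin n) :
    Represents (g Φ i j) (h.calculus.e i (h.calculus.e' j h.calculus.G)) :=
  h.represents_metric i j

theorem eta (k : Fin n) : Represents (fun p => p.2 k) (h.calculus.η k) := represents_eta k

theorem etaBar (k : Fin n) :
    Represents (fun p => starRingEnd ℂ (p.2 k)) (h.calculus.η' k) := (represents_eta k).conj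

theorem connection (k j : Fin n) : Represents (N Φ k j) (h.calculus.N k j) :=
  .sum _ fun m => .sum _ fun l =>
    ((h.represents_inverseMetric m k).mul ((metric h l m).dz j)).mul (eta h l)

theorem delta {F : TCoord n → ℂ} {f : smoothFn U} (hF : Represents F f) (k : Fin n) :
    Represents (delta Φ k F) (h.calculus.δ k f) := by
  rw [h.calculus.δ_apply]
  exact (hF.dz k).sub (.sum _ fun j => (connection h j k).mul (hF.deta j))

theorem deltaBar {F : TCoord n → ℂ} {f : smoothFn U} (hF : Represents F f) (k : Fin n) :
    Represents (deltaBar Φ k F) (h.calculus.δ' k f) := by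
  rw [h.calculus.δ'_apply]
  exact (hF.dzBar k).sub (.sum _ fun j => (connection h j k).conj.mul (hF.detaBar j))

theorem horizontal (i j k : Fin n) : Represents (Lc Φ i j k) (h.calculus.L i j k) :=
  .sum _ fun l => (h.represents_inverseMetric l i).mul ((metric h j l).delta h k)

theorem vertical (i j k : Fin n) : Represents (Cc Φ i j k) (h.calculus.V i j k) :=
  .sum _ fun l => (h.represents_inverseMetric l i).mul ((metric h j l).deta k)

theorem curvature (i j m k : Fin n) : Represents (Rup Φ i j m k)
    (-h.calculus.δ' m (h.calculus.L i j k)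
      - ∑ l, h.calculus.δ' m (h.calculus.N l k) * h.calculus.V i j l) :=
  ((horizontal h i j k).deltaBar h m).neg.sub
    (.sum _ fun l => ((connection h l k).deltaBar h m).mul (vertical h i j l))

theorem lowered (i : Fin n) :
    Represents (fun p => ∑ r, g Φ i r p * starRingEnd ℂ (p.2 r)) (h.calculus.low i) :=
  .sum _ fun r => (metric h i r).mul (etaBar h r)

theorem curvature_lowered (j m k : Fin n) :
    Represents (fun p => ∑ r, R Φ r j m k p * starRingEnd ℂ (p.2 r)) (h.calculus.R₀ j m k) := by
  have e : (fun p => ∑ r, R Φ r j m k p * starRingEnd ℂ (p.2 r)) = fun p =>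
      ∑ i, (∑ r, g Φ i r p * starRingEnd ℂ (p.2 r)) * Rup Φ i j m k p := by
    funext p
    simp only [R, Finset.sum_mul]
    rw [Finset.sum_comm]
    exact Finset.sum_congr rfl fun _ _ => Finset.sum_congr rfl fun _ _ => by ring
  rw [e]
  exact .sum _ fun i => (lowered h i).mul (curvature h i j m k)

/-- The full contraction of the curvature with `η̄^r`, `η̄^m` and `η^j`, the curvature indices being
placed by `a` and `b`. -/
theorem curvature_contract (a b : Fin n → Fin n) :
    Represents (fun p => ∑ r, ∑ m, ∑ j, R Φ r (a j) m (b j) p * starRingEnd ℂ (p.2 r)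
        * starRingEnd ℂ (p.2 m) * p.2 j)
      (∑ m, ∑ j, h.calculus.R₀ (a j) m (b j) * h.calculus.η' m * h.calculus.η j) := by
  have e : (fun p => ∑ r, ∑ m, ∑ j, R Φ r (a j) m (b j) p * starRingEnd ℂ (p.2 r)
        * starRingEnd ℂ (p.2 m) * p.2 j) = fun p => ∑ m, ∑ j,
      (∑ r, R Φ r (a j) m (b j) p * starRingEnd ℂ (p.2 r)) * starRingEnd ℂ (p.2 m) * p.2 j := by
    funext p
    rw [Finset.sum_comm]
    refine Finset.sum_congr rfl fun m _ => ?_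
    rw [Finset.sum_comm]
    simp only [Finset.sum_mul]
  rw [e]
  exact .sum _ fun m => .sum _ fun j =>
    ((curvature_lowered h (a j) m (b j)).mul (etaBar h m)).mul (eta h j)

end Represents

/-! ### The weak Kähler condition in one chart -/

namespace IsLocalMetric

variable {n : ℕ} {U : Opens (TCoord n)} {Φ : TCoord n → ℝ} (h : IsLocalMetric U Φ)
include h

/-- Euler's identity gives `L = g_{i j̄} η^i η̄^j`, which is positive. With `i` as row index, the
Hermitian form is evaluated at `η̄`, hence `star p.2`. -/
theorem Lfun_ne_zero {p : TCoord n} (hp : p ∈ U) (h0 : p.2 ≠ 0) : Lfun Φ p ≠ 0 := by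
  have hx : star p.2 ≠ 0 := fun e => h0 (star_eq_zero.1 e)
  have hpos := (h.posDef p hp).dotProduct_mulVec_pos hx
  have e : star (star p.2) ⬝ᵥ (gMat Φ p).mulVec (star p.2) = Lfun Φ p := by
    rw [← h.euler hp, star_star, dotProduct]
    refine Finset.sum_congr rfl fun i _ => ?_
    congr 1
    have e := Represents.lowered h i
    rw [h.calculus.low_eq] at e
    exact e.eqOn (h.represents_energy.deta i) hp
  rw [e] at hpos
  exact hpos.ne'

/-- Weak symmetry and a nonzero constant `K` make the metric weakly Kähler. -/
theorem torsion_eq_zero (h0 : ∀ p ∈ U, p.2 ≠ 0) (c : ℂ) (hc : c ≠ 0)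
    (hsymm : ∀ p ∈ U, ∀ k : Fin n,
      (∑ r, ∑ m, ∑ j, R Φ r k m j p * conj (p.2 r) * conj (p.2 m) * p.2 j) =
        ∑ r, ∑ m, ∑ j, R Φ r j m k p * conj (p.2 r) * conj (p.2 m) * p.2 j)
    (hK : ∀ p ∈ U, K Φ p = c) {p : TCoord n} (hp : p ∈ U) (k : Fin n) :
    (∑ i, ∑ j, ∑ l, g Φ i l p * T Φ i j k p * p.2 j * conj (p.2 l)) = 0 := by
  have hpos (p) (hp : p ∈ U) : Φ p ≠ 0 := fun e =>
    h.Lfun_ne_zero hp (h0 p hp) (by simp [Lfun, e])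
  -- Smoothness is assumed for `F²` only; it passes to `F` and `1 / F` because `F` has no zero on
  -- `U`.
  have hΦ : ContDiffOn ℝ ∞ (fun p => (Φ p : ℂ)) U := by
    have e : Φ = fun p => Real.sqrt (Φ p ^ 2) := funext fun p => (Real.sqrt_sq (h.nonneg p)).symm
    rw [e]
    exact Complex.ofRealCLM.contDiff.comp_contDiffOn
      (h.smooth.sqrt fun p hp => pow_ne_zero 2 (hpos p hp))
  obtain ⟨φ, hφ⟩ := Represents.exists_of_contDiffOn hΦ
  obtain ⟨ψ, hψ⟩ := Represents.exists_of_contDiffOn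
    (hΦ.inv fun p hp => Complex.ofReal_ne_zero.2 (hpos p hp))
  have hφφ : φ * φ = h.calculus.G := (hφ.mul hφ).unique fun x => by
    have := h.represents_energy x
    rw [show h.calculus.G = h.energy from rfl, ← this, Lfun, pow_two, Complex.ofReal_mul]
  have hφψ : φ * ψ = 1 := (hφ.mul hψ).unique fun x => by
    simpa using mul_inv_cancel₀ (Complex.ofReal_ne_zero.2 (hpos x.1 x.2))
  have hup (i : Fin n) : Represents (lUp Φ i) (h.calculus.η i * ψ) := fun x => by
    rw [← ((Represents.eta h i).mul hψ) x, lUp, div_eq_mul_inv]; rfl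
  have hdown (i : Fin n) : Represents (lDown Φ i) (h.calculus.low i * ψ) := fun x => by
    rw [← ((Represents.lowered h i).mul hψ) x, lDown, div_eq_mul_inv]; rfl
  have hJ : Represents (J Φ) (ψ ^ 3 * h.calculus.P) := by
    rw [← h.calculus.sum_low_L]
    exact .sum _ fun i => .sum _ fun j => .sum _ fun k =>
      (((hup j).mul (hup k)).mul (hdown i)).mul (Represents.horizontal h i j k)
  have hK' : Represents (K Φ) (-ψ * h.calculus.X' (ψ ^ 3 * h.calculus.P)) := by
    rw [h.calculus.X'_apply]
    intro x
    rw [← (hψ.neg.mul (.sum _ fun m => (Represents.etaBar h m).mul (hJ.deltaBar h m))) x, K,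
      one_div]
    rfl
  have hKc : -ψ * h.calculus.X' (ψ ^ 3 * h.calculus.P) = algebraMap ℂ (smoothFn U) c :=
    hK'.unique fun x => hK x x.2
  rw [h.calculus.X'_inv_cube_mul hφφ hφψ] at hKc
  -- At this point `K = -F⁻⁴ X' P`; multiply by `F⁴ = G²`.
  have hX : -h.calculus.X' h.calculus.P =
      algebraMap ℂ (smoothFn U) c * (h.calculus.G * h.calculus.G) := by
    have h4 : φ ^ 4 * ψ ^ 4 = 1 := by rw [← mul_pow, hφψ, one_pow]
    rw [← hKc, ← hφφ]
    linear_combination h.calculus.X' h.calculus.P * h4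
  have hsymm' (k : Fin n) :
      ∑ m, ∑ j, h.calculus.R₀ k m j * h.calculus.η' m * h.calculus.η j =
        ∑ m, ∑ j, h.calculus.R₀ j m k * h.calculus.η' m * h.calculus.η j :=
    (Represents.curvature_contract h (fun _ => k) id).unique fun x =>
      (hsymm x x.2 k).trans (Represents.curvature_contract h id (fun _ => k) x)
  -- `smoothFn U` may have zero divisors, so `c G` is cancelled pointwise, where it is a nonzero
  -- number.
  have hδ (j k : Fin n) : h.calculus.δ j (h.calculus.e k h.calculus.G)
      - h.calculus.δ k (h.calculus.e j h.calculus.G) = 0 := by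
    have e := h.calculus.symm_of_constant c hX hsymm' j k
    refine Subtype.ext <| funext fun x => ?_
    have ex := congrFun (congrArg Subtype.val e) x
    have hL : h.calculus.G.1 x ≠ 0 := h.Lfun_ne_zero x.2 (h0 x x.2)
    have e' : c * (h.calculus.G.1 x * (h.calculus.δ j (h.calculus.e k h.calculus.G)
      - h.calculus.δ k (h.calculus.e j h.calculus.G)).1 x) = 0 := ex
    simpa [hc, hL] using e'
  have hT : Represents (U := U)
      (fun p => ∑ i, ∑ j, ∑ l, g Φ i l p * T Φ i j k p * p.2 j * conj (p.2 l)) 0 := by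
    have e := h.calculus.torsion_contract k
    simp only [hδ, mul_zero, Finset.sum_const_zero] at e
    rw [← e]
    exact .sum _ fun i => .sum _ fun j => .sum _ fun l => (((Represents.metric h i l).mul
      ((Represents.horizontal h i j k).sub (Represents.horizontal h i k j))).mul
        (Represents.eta h j)).mul (Represents.etaBar h l)
  exact hT ⟨p, hp⟩

end IsLocalMetric

/-- Homogeneity descends to coordinates because the differential of a holomorphic chart is
`ℂ`-linear. -/
theorem isLocalMetric_localExpr {n : ℕ} {M : Type*} [TopologicalSpace M]
    [ChartedSpace (Model n) M] [IsManifold 𝓘(ℂ, Model n) ω M]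
    {F : TangentBundle 𝓘(ℂ, Model n) M → ℝ} (hF : IsComplexFinsler F)
    {e : OpenPartialHomeomorph M (Model n)} (he : e ∈ charts n M) :
    IsLocalMetric ⟨slit e, e.open_target.prod isOpen_ne⟩ (localExpr F e) where
  smooth := hF.smooth e he
  nonneg _ := hF.nonneg _
  homogeneous p _ c := by
    have e₁ := (mfderiv 𝓘(ℂ, Model n) 𝓘(ℂ, Model n) e.symm p.1).map_smul c p.2
    exact (congrArg (fun v : TangentSpace 𝓘(ℂ, Model n) (e.symm p.1) =>
      F ⟨e.symm p.1, v⟩) e₁).trans (hF.homogeneous _ _ c)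
  posDef := hF.posDef e he

end CFinsler

end

theorem theorem4p9 {M : Type*} [TopologicalSpace M] [ConnectedSpace M]
    [ChartedSpace (CFinsler.Model 2) M] [IsManifold 𝓘(ℂ, CFinsler.Model 2) ω M]
    (F : TangentBundle 𝓘(ℂ, CFinsler.Model 2) M → ℝ) (hF : CFinsler.IsComplexFinsler F)
    (hsymm : CFinsler.WeaklySymmetric F) (hA : CFinsler.ANeZero F)
    (c : ℂ) (hc : c ≠ 0) (hK : CFinsler.ConstantK F c) :
    CFinsler.WeaklyKaehler F := by
  intro e he p hp k
  exact (CFinsler.isLocalMetric_localExpr hF he).torsion_eq_zero (fun _ hp => hp.2) c hc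
    (hsymm e he) (hK e he) hp k
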